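/- Let $(I,\mathcal T)$ be a locally finite tree with root $r$. Write $|i|$ for the distance from $i$ to $r$, $i\preceq j$ if $i$ lies on the geodesic from $r$ to $j$, $i^-$ for the predecessor of $i\neq r$ (its neighbour with $i^-\preceq i$), $S_i=\{j: j^-=i\}$ for the set of successors of $i$, and $B^n=\{i\in I:|i|=n\}$. Assume that every branch $\{j: i\preceq j\}$, $i\in I$, is infinite. Let $\partial_\infty$ be the boundary of the tree: its points are the infinite chains $\xi=(\xi(0)=r,\xi(1),\xi(2),\dots)$ of distinct, successively adjacent vertices starting at the root, and it carries the topology generated by the sets $\{\xi: i\in\{\xi(n):n\ge 0\}\}$, $i\in I$, and the Borel $\sigma$-algebra of this topology. Let $w:\mathbb N\to(0,\infty)$ be strictly increasing, put $w_{-1}=0$, and for $i\in I$, $\xi\in\partial_\infty$ let $U_{i\xi}=w_{|i\wedge\xi|}$, where $i\wedge\xi$ is the vertex farthest from $r$ that is common to the geodesic from $r$ to $i$ and to $\xi$. Let $Q$ be the matrix on $I$ with $$Q_{ii^-}=Q_{i^-i}=(w_{|i|}-w_{|i|-1})^{-1}\ (i\neq r),\qquad Q_{ii}=-\big((w_{|i|}-w_{|i|-1})^{-1}+|S_i|\,(w_{|i|+1}-w_{|i|})^{-1}\big),$$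 and all other entries $0$. A function $h:I\to\mathbb R$ is harmonic if $Qh=0$, and increasing if $i\preceq j$ implies $h(i)\le h(j)$. Let $h:I\to\mathbb R$ be a bounded harmonic function. Then there is a finite signed measure $\nu$ on $\partial_\infty$ with $$h(i)=\int_{\partial_\infty}U_{i\xi}\,d\nu(\xi)\quad\text{for every } i\in I$$ if and only if $$\sup_{n\ge 1}\ \frac{1}{w_n-w_{n-1}}\sum_{j\in B^n}|h(j)-h(j^-)|<\infty .$$ In that case, for every such $\nu$ with positive and negative parts $\nu^+,\nu^-$ (Jordan decomposition), the functions $h^\pm(i)=\int_{\partial_\infty}U_{i\xi}\,d\nu^\pm(\xi)$ are nonnegative, increasing and harmonic, and $h=h^+-h^-$. -/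

import Mathlib

open MeasureTheory

noncomputable section

namespace TreeMatrix

variable {I : Type*}

/-- The level `|i|`: the length of the geodesic from the root `r` to `i`. -/
def level (G : SimpleGraph I) (r i : I) : ℕ := G.dist r i

/-- The set of vertices of the geodesic from `r` to `j`; in a tree it is the unique path
from `r` to `j`. -/
def geod (G : SimpleGraph I) (r j : I) : Set I :=
  {i | ∃ p : G.Walk r j, p.IsPath ∧ i ∈ p.support}

/-- The order `i ≼ j`: `i` lies on the geodesic from the root to `j`. -/
def Prec (G : SimpleGraph I) (r i j : I) : Prop := i ∈ geod G r j

/-- The branch `[i, ∞)` born at `i`. -/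
def branch (G : SimpleGraph I) (r i : I) : Set I := {j | Prec G r i j}

/-- `i` is the predecessor of `j`: they are neighbours and `i ≼ j`. -/
def IsPred (G : SimpleGraph I) (r i j : I) : Prop := G.Adj i j ∧ Prec G r i j

/-- The set `S_i` of successors of `i`. -/
def succs (G : SimpleGraph I) (r i : I) : Set I := {j | IsPred G r i j}

open Classical in
/-- The predecessor `j⁻` of a vertex `j ≠ r` of a tree. (The root has none in the tree; the value
given there is never used below.) -/
def pred (G : SimpleGraph I) (r j : I) : I :=
  if h : ∃ i, IsPred G r i j then h.choose else j

/-- The sphere `B^n` of the vertices of level `n`. -/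
def sphere (G : SimpleGraph I) (r : I) (n : ℕ) : Set I := {i | level G r i = n}

/-- The increments `w_n - w_{n-1}`, with the convention `w_{-1} = 0`. -/
def delta (w : ℕ → ℝ) : ℕ → ℝ
  | 0 => w 0
  | n + 1 => w (n + 1) - w n

open Classical in
/-- The `q`-matrix `Q` of the tree matrix of weight `w`. -/
def Q (G : SimpleGraph I) (r : I) (w : ℕ → ℝ) : Matrix I I ℝ := fun i j =>
  if i = j then
    -((delta w (level G r i))⁻¹
      + ((succs G r i).ncard : ℝ) * (delta w (level G r i + 1))⁻¹)
  else if IsPred G r j i then (delta w (level G r i))⁻¹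
  else if IsPred G r i j then (delta w (level G r j))⁻¹
  else 0

/-- `h` is harmonic: `Q h = 0`. In a locally finite graph the rows of `Q` have finite support, so
that the sums are finite. -/
def IsHarmonic (G : SimpleGraph I) (r : I) (w : ℕ → ℝ) (h : I → ℝ) : Prop :=
  ∀ i, ∑ᶠ j, Q G r w i j * h j = 0

/-- `f` is increasing along the branches of the tree. -/
def IsIncreasing (G : SimpleGraph I) (r : I) (f : I → ℝ) : Prop :=
  ∀ i j, Prec G r i j → f i ≤ f j

/-- The boundary of the rooted tree. Two infinite chains are equivalent if they have infinitely many
vertices in common, and each class contains exactly one chain that starts at the root; a boundary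
point is given as this chain `ξ(0) = r, ξ(1), ξ(2), …`. -/
structure Boundary (G : SimpleGraph I) (r : I) where
  /-- the vertex `ξ(n)` -/
  vertex : ℕ → I
  vertex_zero : vertex 0 = r
  adj : ∀ n, G.Adj (vertex n) (vertex (n + 1))
  injective : Function.Injective vertex

/-- The set of vertices of the geodesic from the root to the boundary point `ξ`. -/
def Boundary.geod {G : SimpleGraph I} {r : I} (ξ : Boundary G r) : Set I := Set.range ξ.vertex

/-- The set of the boundary points below `i`. -/
def cylinder (G : SimpleGraph I) (r i : I) : Set (Boundary G r) := {ξ | i ∈ ξ.geod}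

/-- The topology of the boundary, generated by the cylinders. -/
instance (G : SimpleGraph I) (r : I) : TopologicalSpace (Boundary G r) :=
  TopologicalSpace.generateFrom (Set.range (cylinder G r))

/-- The boundary carries its Borel `σ`-algebra. -/
instance (G : SimpleGraph I) (r : I) : MeasurableSpace (Boundary G r) := borel _

instance (G : SimpleGraph I) (r : I) : BorelSpace (Boundary G r) := ⟨rfl⟩

/-- The level `|i ∧ ξ|` of the farthest vertex from the root that is common to the geodesics from
the root to `i` and to `ξ`. -/
def meetLevel (G : SimpleGraph I) (r i : I) (ξ : Boundary G r) : ℕ :=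
  sSup (level G r '' (geod G r i ∩ ξ.geod))

/-- The tree matrix extended to the boundary: `U_{iξ} = w_{|i ∧ ξ|}`. -/
def U (G : SimpleGraph I) (r : I) (w : ℕ → ℝ) (i : I) (ξ : Boundary G r) : ℝ :=
  w (meetLevel G r i ξ)

/-- The number `(w_n - w_{n-1})⁻¹ ∑_{j ∈ B^n} |h(j) - h(j⁻)|`. In a connected locally finite graph
the sphere is finite, so that the sum is finite. -/
def levelVariation (G : SimpleGraph I) (r : I) (w : ℕ → ℝ) (h : I → ℝ) (n : ℕ) : ℝ :=
  (delta w n)⁻¹ * ∑ᶠ j ∈ sphere G r n, |h j - h (pred G r j)|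

/-- The finite variation condition: the numbers above are bounded for `n ≥ 1`. -/
def FiniteVariation (G : SimpleGraph I) (r : I) (w : ℕ → ℝ) (h : I → ℝ) : Prop :=
  BddAbove (levelVariation G r w h '' Set.Ici 1)

/-- `h(i) = ∫ U_{iξ} dν(ξ)` for every `i`. -/
def IsRepresentedBy (G : SimpleGraph I) (r : I) (w : ℕ → ℝ) (h : I → ℝ)
    (ν : SignedMeasure (Boundary G r)) : Prop :=
  ∀ i, h i = ∫ᵛ ξ, U G r w i ξ ∂<•ν

end TreeMatrix

end

/-! Let m(i) = (h(i) - h(i⁻)) / (w_{|i|} - w_{|i|-1}), with h(r⁻) = 0. Then Qh = 0 says exactly that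
m(i) is the sum of m over the successors of i (`isHarmonic_iff`): m is an additive function on the
cylinders of the boundary. It determines h, and when h is the potential of a finite measure, m(i) is
the mass of the cylinder of i (`slope_integral_U`). The level-n variation of h is the sum of |m|
over `B^n`, so the theorem asks when an additive cylinder function comes from a finite signed
measure.

If it does, the total mass of ν⁺ + ν⁻ bounds every level. Conversely, put the masses m(j)⁺, and
separately m(j)⁻, with |j| = n, at points of the corresponding cylinders. Bounded variation and
compactness of the boundary give limit measures along an ultrafilter (`exists_measure_tendsto_sum`).
Cylinders are clopen, so the limits see them, and by additivity the difference of the two masses of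
a cylinder is already m(i) for all n ≥ |i|. -/

noncomputable section

namespace TreeMatrix

variable {I : Type*} {G : SimpleGraph I} {r i j k : I} {w : ℕ → ℝ}

/-! ### Combinatorics of a rooted tree -/

@[simp] lemma level_root : level G r r = 0 := by simp [level]

lemma level_eq_zero_iff (hG : G.IsTree) : level G r i = 0 ↔ i = r := by
  rw [level, hG.connected.dist_eq_zero_iff, eq_comm]

lemma prec_iff_mem_support (hG : G.IsTree) {p : G.Walk r j} (hp : p.IsPath) :
    Prec G r i j ↔ i ∈ p.support := by
  refine ⟨?_, fun h => ⟨p, hp, h⟩⟩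
  rintro ⟨q, hq, hi⟩
  rwa [(hG.existsUnique_path r j).unique hp hq]

lemma prec_refl (hG : G.IsTree) (i : I) : Prec G r i i := by
  obtain ⟨p, hp, -⟩ := hG.connected.exists_path_of_dist r i
  exact ⟨p, hp, p.end_mem_support⟩

lemma level_le_of_prec (hG : G.IsTree) (h : Prec G r i j) : level G r i ≤ level G r j := by
  classical
  obtain ⟨p, hp, hl⟩ := hG.connected.exists_path_of_dist r j
  rw [prec_iff_mem_support hG hp] at h
  rw [level, level, ← hl]
  exact (SimpleGraph.dist_le (p.takeUntil i h)).trans (p.length_takeUntil_le_length h)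

lemma isPred_iff (hG : G.IsTree) :
    IsPred G r i j ↔ G.Adj i j ∧ level G r j = level G r i + 1 := by
  refine and_congr_right fun hadj => ⟨fun h => ?_, fun h => ?_⟩
  · have h₁ := level_le_of_prec hG h
    have h₂ := hG.dist_eq_dist_add_one_of_adj r hadj
    simp only [level] at *
    omega
  · obtain ⟨p, -, hl⟩ := hG.connected.exists_path_of_dist r i
    refine ⟨p.concat hadj, (p.concat hadj).isPath_of_length_eq_dist ?_, ?_⟩
    · rw [SimpleGraph.Walk.length_concat, hl]
      exact h.symm
    · simp [SimpleGraph.Walk.support_concat]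

lemma IsPred.level_eq (hG : G.IsTree) (h : IsPred G r i j) :
    level G r j = level G r i + 1 := ((isPred_iff hG).1 h).2

lemma IsPred.ne_root (hG : G.IsTree) (h : IsPred G r i j) : j ≠ r := by
  rintro rfl
  simpa using h.level_eq hG

/-- The geodesic to `j` is the geodesic to `i` with `j` appended. -/
lemma IsPred.prec_iff (hG : G.IsTree) (h : IsPred G r i j) :
    Prec G r k j ↔ k = j ∨ Prec G r k i := by
  obtain ⟨p, hp, -⟩ := hG.connected.exists_path_of_dist r i
  obtain ⟨q, hq, -⟩ := hG.connected.exists_path_of_dist r j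
  have hi : i ∈ q.support := (prec_iff_mem_support hG hq).1 h.2
  rw [prec_iff_mem_support hG hp, prec_iff_mem_support hG hq,
    hG.isAcyclic.path_concat hp hq h.1 hi, SimpleGraph.Walk.support_concat]
  simp [or_comm]

lemma IsPred.unique (hG : G.IsTree) (h : IsPred G r i j) (h' : IsPred G r k j) : i = k := by
  obtain ⟨q, hq, -⟩ := hG.connected.exists_path_of_dist r j
  rw [hG.isAcyclic.eq_penultimate_of_adj_end hq h.1.symm ((prec_iff_mem_support hG hq).1 h.2),
    hG.isAcyclic.eq_penultimate_of_adj_end hq h'.1.symm ((prec_iff_mem_support hG hq).1 h'.2)]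

lemma isPred_pred (hG : G.IsTree) (h : j ≠ r) : IsPred G r (pred G r j) j := by
  have hex : ∃ i, IsPred G r i j := by
    obtain ⟨q, hq, -⟩ := hG.connected.exists_path_of_dist r j
    have hnil : ¬ q.Nil := SimpleGraph.Walk.not_nil_of_ne h.symm
    exact ⟨q.penultimate, q.adj_penultimate hnil,
      (prec_iff_mem_support hG hq).2 (q.getVert_mem_support _)⟩
  rw [pred, dif_pos hex]
  exact hex.choose_spec

lemma IsPred.pred_eq (hG : G.IsTree) (h : IsPred G r i j) : pred G r j = i :=
  (isPred_pred hG (h.ne_root hG)).unique hG h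

lemma prec_root_iff (hG : G.IsTree) : Prec G r i r ↔ i = r := by
  refine ⟨fun h => (level_eq_zero_iff hG).1 ?_, ?_⟩
  · simpa using level_le_of_prec hG h
  · rintro rfl
    exact prec_refl hG _

/-- Induction along the predecessors in a rooted tree. -/
lemma pred_induction (hG : G.IsTree) {P : I → Prop} (root : P r)
    (step : ∀ i j, IsPred G r i j → P i → P j) (j : I) : P j := by
  induction hn : level G r j generalizing j with
  | zero => rwa [(level_eq_zero_iff hG).1 hn]
  | succ n ih =>
    have hj : j ≠ r := by
      rintro rfl
      simp at hn
    have hp := isPred_pred hG hj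
    have := hp.level_eq hG
    exact step _ _ hp (ih _ (by omega))

lemma isIncreasing_of_isPred (hG : G.IsTree) {f : I → ℝ}
    (hf : ∀ i j, IsPred G r i j → f i ≤ f j) : IsIncreasing G r f := by
  intro i j
  induction j using pred_induction hG (r := r) with
  | root =>
    intro h
    rw [(prec_root_iff hG).1 h]
  | step k j hkj ih =>
    intro h
    rcases (hkj.prec_iff hG).1 h with rfl | h
    · exact le_rfl
    · exact (ih h).trans (hf _ _ hkj)

lemma exists_isPred_of_infinite_branch (hG : G.IsTree) (h : (branch G r i).Infinite) :
    ∃ j, IsPred G r i j := by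
  by_contra! hno
  refine h ((Set.finite_singleton i).subset fun j hj => ?_)
  simp only [branch, Set.mem_ofPred_eq] at hj
  induction j using pred_induction hG (r := r) with
  | root => exact ((prec_root_iff hG).1 hj).symm
  | step k j hkj ih =>
    rcases (hkj.prec_iff hG).1 hj with rfl | hj
    · rfl
    · obtain rfl : k = i := ih hj
      exact absurd hkj (hno j)

open Classical in
/-- The successors of a vertex of a locally finite tree. -/
def succFinset (G : SimpleGraph I) [G.LocallyFinite] (r i : I) : Finset I :=
  (G.neighborFinset i).filter (IsPred G r i)

@[simp] lemma mem_succFinset [G.LocallyFinite] : j ∈ succFinset G r i ↔ IsPred G r i j := by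
  simp only [succFinset, Finset.mem_filter, SimpleGraph.mem_neighborFinset, and_iff_right_iff_imp]
  exact fun h => h.1

lemma coe_succFinset [G.LocallyFinite] : (succFinset G r i : Set I) = succs G r i := by
  ext j
  simp [succs]

open Classical in
/-- The sphere of radius `n` of a locally finite tree. -/
def sphereFinset (G : SimpleGraph I) [G.LocallyFinite] (r : I) : ℕ → Finset I
  | 0 => {r}
  | n + 1 => (sphereFinset G r n).biUnion (succFinset G r)

lemma mem_sphereFinset [G.LocallyFinite] (hG : G.IsTree) {n : ℕ} :
    i ∈ sphereFinset G r n ↔ level G r i = n := by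
  induction n generalizing i with
  | zero => simp [sphereFinset, level_eq_zero_iff hG]
  | succ n ih =>
    simp only [sphereFinset, Finset.mem_biUnion, mem_succFinset, ih]
    constructor
    · rintro ⟨k, rfl, hk⟩
      exact hk.level_eq hG
    · intro h
      have hi : i ≠ r := by
        rintro rfl
        simp at h
      have hp := isPred_pred hG hi
      exact ⟨_, by have := hp.level_eq hG; omega, hp⟩

lemma coe_sphereFinset [G.LocallyFinite] (hG : G.IsTree) (n : ℕ) :
    (sphereFinset G r n : Set I) = sphere G r n := by
  ext j
  simp [sphere, mem_sphereFinset hG]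

lemma sum_sphereFinset_succ [G.LocallyFinite] (hG : G.IsTree) (f : I → ℝ) (n : ℕ) :
    ∑ j ∈ sphereFinset G r (n + 1), f j
      = ∑ i ∈ sphereFinset G r n, ∑ j ∈ succFinset G r i, f j := by
  classical
  rw [sphereFinset, Finset.sum_biUnion]
  intro i _ k _ hik
  rw [Function.onFun, Finset.disjoint_left]
  intro j hj hj'
  rw [mem_succFinset] at hj hj'
  exact hik (hj.unique hG hj')

/-! ### The increments of a function and harmonicity -/

open Classical in
/-- The normalized increment `(h(i) - h(i⁻)) / (w_{|i|} - w_{|i|-1})`, with `h(r⁻) = 0`. -/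
def slope (G : SimpleGraph I) (r : I) (w : ℕ → ℝ) (h : I → ℝ) (i : I) : ℝ :=
  (delta w (level G r i))⁻¹ * (h i - if i = r then 0 else h (pred G r i))

lemma delta_pos (hw_pos : ∀ n, 0 < w n) (hw_mono : StrictMono w) (n : ℕ) : 0 < delta w n := by
  cases n with
  | zero => exact hw_pos 0
  | succ n => exact sub_pos.2 (hw_mono n.lt_succ_self)

lemma slope_root (h : I → ℝ) : slope G r w h r = (delta w 0)⁻¹ * h r := by
  simp [slope]

lemma IsPred.slope_eq (hG : G.IsTree) (hij : IsPred G r i j) (h : I → ℝ) :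
    slope G r w h j = (delta w (level G r j))⁻¹ * (h j - h i) := by
  rw [slope, if_neg (hij.ne_root hG), hij.pred_eq hG]

/-- Distributing the diagonal entry of row `i` over the edges at `i` turns the row into a balance of
slopes. At the root there is no predecessor term, and the convention w_{-1} = 0 makes what remains
of the diagonal the slope at `r`. -/
lemma finsum_Q_mul [G.LocallyFinite] (hG : G.IsTree) (h : I → ℝ) (i : I) :
    ∑ᶠ j, Q G r w i j * h j = ∑ j ∈ succFinset G r i, slope G r w h j - slope G r w h i := by
  classical
  have hS : ∀ j ∈ succFinset G r i, Q G r w i j * h j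
      = slope G r w h j + (delta w (level G r i + 1))⁻¹ * h i := by
    intro j hj
    rw [mem_succFinset] at hj
    have hji : ¬ IsPred G r j i := fun h' => by
      have := h'.level_eq hG
      have := hj.level_eq hG
      omega
    rw [Q, if_neg hj.1.ne, if_neg hji, if_pos hj, hj.slope_eq hG, hj.level_eq hG]
    ring
  have hncard : (succs G r i).ncard = (succFinset G r i).card := by
    rw [← coe_succFinset, Set.ncard_coe_finset]
  have hi : i ∉ succFinset G r i := by
    rw [mem_succFinset]
    exact fun h' => h'.1.ne rfl
  by_cases hir : i = r
  · subst hir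
    rw [finsum_eq_sum_of_support_subset (s := insert i (succFinset G i i)),
      Finset.sum_insert hi, Finset.sum_congr rfl hS, Finset.sum_add_distrib, Finset.sum_const,
      slope_root, Q, if_pos rfl, hncard, level_root, nsmul_eq_mul]
    · ring
    · intro j hj
      by_contra hne
      simp only [Finset.coe_insert, Set.mem_insert_iff, Finset.mem_coe, mem_succFinset,
        not_or] at hne
      refine hj ?_
      change Q G i w i j * h j = 0
      rw [Q, if_neg (Ne.symm hne.1), if_neg (fun h' => h'.ne_root hG rfl), if_neg hne.2, zero_mul]
  · have hp := isPred_pred hG hir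
    have hpS : pred G r i ∉ succFinset G r i := by
      rw [mem_succFinset]
      intro h'
      have := h'.level_eq hG
      have := hp.level_eq hG
      omega
    rw [finsum_eq_sum_of_support_subset (s := insert i (insert (pred G r i) (succFinset G r i))),
      Finset.sum_insert (by simpa [hp.1.ne.symm] using hi), Finset.sum_insert hpS,
      Finset.sum_congr rfl hS, Finset.sum_add_distrib, Finset.sum_const,
      hp.slope_eq hG, Q, if_pos rfl, hncard, nsmul_eq_mul, Q, if_neg hp.1.ne.symm, if_pos hp]
    · ring
    · intro j hj
      by_contra hne
      simp only [Finset.coe_insert, Set.mem_insert_iff, Finset.mem_coe, mem_succFinset,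
        not_or] at hne
      refine hj ?_
      change Q G r w i j * h j = 0
      rw [Q, if_neg (Ne.symm hne.1), if_neg (fun h' => hne.2.1 (h'.pred_eq hG).symm),
        if_neg hne.2.2, zero_mul]

lemma isHarmonic_iff [G.LocallyFinite] (hG : G.IsTree) (h : I → ℝ) :
    IsHarmonic G r w h ↔ ∀ i, ∑ j ∈ succFinset G r i, slope G r w h j = slope G r w h i := by
  simp only [IsHarmonic, finsum_Q_mul hG, sub_eq_zero]

lemma slope_sub (f g : I → ℝ) (i : I) :
    slope G r w (fun i => f i - g i) i = slope G r w f i - slope G r w g i := by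
  unfold slope
  split_ifs <;> ring

lemma eq_of_slope_eq (hG : G.IsTree) (hw : ∀ n, 0 < delta w n) {f g : I → ℝ}
    (h : ∀ i, slope G r w f i = slope G r w g i) (i : I) : f i = g i := by
  induction i using pred_induction hG (r := r) with
  | root => simpa [slope_root, (hw 0).ne'] using h r
  | step i j hij ih =>
    have := h j
    rw [hij.slope_eq hG, hij.slope_eq hG, ih] at this
    simpa [(hw _).ne'] using this

/-- Level 0 is excluded because `pred` has a default value at the root, whereas `slope` uses 0
there. -/
lemma levelVariation_eq_sum [G.LocallyFinite] (hG : G.IsTree) (hw : ∀ n, 0 < delta w n)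
    (h : I → ℝ) {n : ℕ} (hn : 1 ≤ n) :
    levelVariation G r w h n = ∑ j ∈ sphereFinset G r n, |slope G r w h j| := by
  rw [levelVariation, ← coe_sphereFinset hG, finsum_mem_coe_finset, Finset.mul_sum]
  refine Finset.sum_congr rfl fun j hj => ?_
  rw [mem_sphereFinset hG] at hj
  have hjr : j ≠ r := by
    rintro rfl
    simp at hj
    omega
  rw [(isPred_pred hG hjr).slope_eq hG, abs_mul, abs_of_pos (inv_pos.2 (hw _)), hj]

open Classical in
lemma sum_sphereFinset_prec [G.LocallyFinite] (hG : G.IsTree) {m : I → ℝ}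
    (hm : ∀ i, ∑ j ∈ succFinset G r i, m j = m i) (i : I) {n : ℕ} (hn : level G r i ≤ n) :
    ∑ j ∈ sphereFinset G r n, (if Prec G r i j then m j else 0) = m i := by
  induction n, hn using Nat.le_induction with
  | base =>
    rw [Finset.sum_eq_single_of_mem i ((mem_sphereFinset hG).2 rfl), if_pos (prec_refl hG i)]
    intro j hj hji
    rw [mem_sphereFinset hG] at hj
    refine if_neg fun h => ?_
    have hjr : j ≠ r := by
      rintro rfl
      exact hji ((prec_root_iff hG).1 h).symm
    have hp := isPred_pred hG hjr
    rcases (hp.prec_iff hG).1 h with h | h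
    · exact hji h.symm
    · have := level_le_of_prec hG h
      have := hp.level_eq hG
      omega
  | succ n hn ih =>
    rw [sum_sphereFinset_succ hG, ← ih]
    refine Finset.sum_congr rfl fun k hk => ?_
    rw [mem_sphereFinset hG] at hk
    have hk' : ∀ j ∈ succFinset G r k, Prec G r i j ↔ Prec G r i k := by
      intro j hj
      rw [mem_succFinset] at hj
      rw [hj.prec_iff hG, or_iff_right]
      rintro rfl
      have := hj.level_eq hG
      omega
    rw [Finset.sum_congr rfl fun j hj => if_congr (hk' j hj) rfl rfl]
    split_ifs
    · exact hm k
    · exact Finset.sum_const_zero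

/-! ### The boundary of a rooted tree -/

namespace Boundary

/-- Both claims go through one induction: a step back towards the root would lead to the unique
predecessor, a vertex already visited, against injectivity. -/
lemma isPred_and_level (hG : G.IsTree) (ξ : Boundary G r) (n : ℕ) :
    IsPred G r (ξ.vertex n) (ξ.vertex (n + 1)) ∧ level G r (ξ.vertex n) = n := by
  induction n with
  | zero =>
    have h0 : level G r (ξ.vertex 0) = 0 := by simp [ξ.vertex_zero]
    refine ⟨(isPred_iff hG).2 ⟨ξ.adj 0, ?_⟩, h0⟩
    have := hG.dist_eq_dist_add_one_of_adj r (ξ.adj 0)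
    simp only [level] at *
    omega
  | succ n ih =>
    obtain ⟨hp, hl⟩ := ih
    have hl' : level G r (ξ.vertex (n + 1)) = n + 1 := by rw [hp.level_eq hG, hl]
    refine ⟨(isPred_iff hG).2 ⟨ξ.adj _, ?_⟩, hl'⟩
    rcases hG.dist_eq_dist_add_one_of_adj r (ξ.adj (n + 1)) with h | h
    · have hp' : IsPred G r (ξ.vertex (n + 1 + 1)) (ξ.vertex (n + 1)) :=
        (isPred_iff hG).2 ⟨(ξ.adj _).symm, h⟩
      have := ξ.injective (hp.unique hG hp')
      omega
    · exact h

lemma isPred (hG : G.IsTree) (ξ : Boundary G r) (n : ℕ) :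
    IsPred G r (ξ.vertex n) (ξ.vertex (n + 1)) := (ξ.isPred_and_level hG n).1

lemma level_vertex (hG : G.IsTree) (ξ : Boundary G r) (n : ℕ) :
    level G r (ξ.vertex n) = n := (ξ.isPred_and_level hG n).2

/-- The boundary point given by a chain of successive predecessors. -/
def ofIsPred (hG : G.IsTree) (x : ℕ → I) (h0 : x 0 = r)
    (hx : ∀ n, IsPred G r (x n) (x (n + 1))) : Boundary G r where
  vertex := x
  vertex_zero := h0
  adj n := (hx n).1
  injective := by
    have hl : ∀ n, level G r (x n) = n := by
      intro n
      induction n with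
      | zero => simp [h0]
      | succ n ih => rw [(hx n).level_eq hG, ih]
    intro m n hmn
    rw [← hl m, hmn, hl n]

end Boundary

lemma mem_cylinder_iff (hG : G.IsTree) {ξ : Boundary G r} :
    ξ ∈ cylinder G r i ↔ ξ.vertex (level G r i) = i := by
  constructor
  · rintro ⟨n, rfl⟩
    rw [ξ.level_vertex hG]
  · exact fun h => ⟨_, h⟩

lemma prec_vertex_iff (hG : G.IsTree) (ξ : Boundary G r) (n : ℕ) :
    Prec G r i (ξ.vertex n) ↔ ξ ∈ cylinder G r i ∧ level G r i ≤ n := by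
  induction n with
  | zero =>
    rw [ξ.vertex_zero, prec_root_iff hG, Nat.le_zero, level_eq_zero_iff hG,
      eq_comm (a := i) (b := r), mem_cylinder_iff hG]
    constructor
    · rintro rfl
      simp [ξ.vertex_zero]
    · exact fun h => h.2
  | succ n ih =>
    rw [(ξ.isPred hG n).prec_iff hG, ih, mem_cylinder_iff hG]
    constructor
    · rintro (rfl | h)
      · simp [ξ.level_vertex hG]
      · exact ⟨h.1, h.2.trans n.le_succ⟩
    · rintro ⟨h, hn⟩
      rcases hn.eq_or_lt with hn | hn
      · rw [hn] at h
        exact Or.inl h.symm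
      · exact Or.inr ⟨h, by omega⟩

lemma mem_cylinder_iff_prec (hG : G.IsTree) {ξ : Boundary G r} (hj : ξ ∈ cylinder G r j)
    (hij : level G r i ≤ level G r j) : ξ ∈ cylinder G r i ↔ Prec G r i j := by
  have := prec_vertex_iff hG ξ (i := i) (level G r j)
  rw [(mem_cylinder_iff hG).1 hj] at this
  rw [this, and_iff_left hij]

@[simp] lemma cylinder_root : cylinder G r r = Set.univ :=
  Set.eq_univ_of_forall fun ξ => ⟨0, ξ.vertex_zero⟩

lemma disjoint_cylinder (hG : G.IsTree) (hij : level G r i = level G r j) (hne : i ≠ j) :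
    Disjoint (cylinder G r i) (cylinder G r j) := by
  rw [Set.disjoint_left]
  intro ξ hi hj
  rw [mem_cylinder_iff hG] at hi hj
  exact hne (hi.symm.trans (hij ▸ hj))

lemma cylinder_eq_biUnion_succFinset [G.LocallyFinite] (hG : G.IsTree) (i : I) :
    cylinder G r i = ⋃ j ∈ succFinset G r i, cylinder G r j := by
  ext ξ
  simp only [Set.mem_iUnion, mem_succFinset, exists_prop]
  constructor
  · intro h
    refine ⟨ξ.vertex (level G r i + 1), ?_, ⟨_, rfl⟩⟩
    have := ξ.isPred hG (level G r i)
    rwa [(mem_cylinder_iff hG).1 h] at this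
  · rintro ⟨j, hij, hj⟩
    exact (mem_cylinder_iff_prec hG hj (by rw [hij.level_eq hG]; omega)).2 hij.2

lemma iUnion_cylinder_sphereFinset [G.LocallyFinite] (hG : G.IsTree) (n : ℕ) :
    ⋃ j ∈ sphereFinset G r n, cylinder G r j = Set.univ := by
  refine Set.eq_univ_of_forall fun ξ => ?_
  simp only [Set.mem_iUnion, mem_sphereFinset hG, exists_prop]
  exact ⟨ξ.vertex n, ξ.level_vertex hG n, ⟨n, rfl⟩⟩

/-- Follow the geodesic from `r` to `i`, then keep choosing successors; infinite branches rule out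
dead ends. -/
lemma cylinder_nonempty (hG : G.IsTree) (hbranch : ∀ i, (branch G r i).Infinite) (i : I) :
    (cylinder G r i).Nonempty := by
  choose s hs using fun i => exists_isPred_of_infinite_branch hG (hbranch i)
  have hup : ∀ n j, level G r j = n →
      ∃ x : ℕ → I, x 0 = r ∧ x n = j ∧ ∀ k < n, IsPred G r (x k) (x (k + 1)) := by
    intro n
    induction n with
    | zero => exact fun j hj => ⟨fun _ => r, rfl, ((level_eq_zero_iff hG).1 hj).symm, by simp⟩
    | succ n ih =>
      intro j hj
      have hjr : j ≠ r := by
        rintro rfl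
        simp at hj
      have hp := isPred_pred hG hjr
      obtain ⟨x, hx0, hxn, hx⟩ := ih (pred G r j) (by have := hp.level_eq hG; omega)
      refine ⟨fun k => if k ≤ n then x k else j, by simpa using hx0, by simp, fun k hk => ?_⟩
      rcases (Nat.lt_succ_iff.1 hk).eq_or_lt with rfl | hk
      · simpa [hxn] using hp
      · simpa [hk.le, Nat.succ_le_of_lt hk] using hx k hk
  obtain ⟨x, hx0, hxn, hx⟩ := hup _ i rfl
  set n := level G r i
  refine ⟨Boundary.ofIsPred hG (fun k => if k ≤ n then x k else s^[k - n] i)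
    (by simpa using hx0) fun k => ?_, n, by simpa [Boundary.ofIsPred] using hxn⟩
  rcases lt_trichotomy k n with hk | rfl | hk
  · simpa [hk.le, Nat.succ_le_of_lt hk] using hx k hk
  · simpa [hxn] using hs i
  · have h₁ : ¬ k + 1 ≤ n := by omega
    have h₂ : k + 1 - n = (k - n) + 1 := by omega
    simp only [hk.not_ge, h₁, if_false, h₂, Function.iterate_succ_apply']
    exact hs _

/-! ### The topology of the boundary -/

lemma isOpen_cylinder (i : I) : IsOpen (cylinder G r i) :=
  TopologicalSpace.isOpen_generateFrom_of_mem ⟨i, rfl⟩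

lemma measurableSet_cylinder (i : I) : MeasurableSet (cylinder G r i) :=
  (isOpen_cylinder i).measurableSet

lemma isClopen_cylinder (hG : G.IsTree) (i : I) : IsClopen (cylinder G r i) := by
  refine ⟨⟨?_⟩, isOpen_cylinder i⟩
  have : (cylinder G r i)ᶜ
      = ⋃ j ∈ {j | level G r j = level G r i ∧ j ≠ i}, cylinder G r j := by
    ext ξ
    simp only [Set.mem_compl_iff, Set.mem_iUnion, exists_prop, Set.mem_ofPred_eq]
    constructor
    · intro h
      exact ⟨ξ.vertex (level G r i), ⟨ξ.level_vertex hG _, fun h' => h ⟨_, h'⟩⟩, ⟨_, rfl⟩⟩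
    · rintro ⟨j, ⟨hl, hne⟩, hj⟩
      exact (disjoint_cylinder hG hl hne).notMem_of_mem_left hj
  rw [this]
  exact isOpen_biUnion fun j _ => isOpen_cylinder j

lemma t2Space_boundary (hG : G.IsTree) : T2Space (Boundary G r) := by
  refine ⟨fun ξ η hne => ?_⟩
  obtain ⟨n, hn⟩ : ∃ n, ξ.vertex n ≠ η.vertex n := by
    by_contra! h
    cases ξ
    cases η
    simp only [ne_eq, Boundary.mk.injEq] at hne
    exact hne (funext h)
  exact ⟨_, _, isOpen_cylinder (ξ.vertex n), isOpen_cylinder (η.vertex n), ⟨n, rfl⟩, ⟨n, rfl⟩,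
    disjoint_cylinder hG (by rw [ξ.level_vertex hG, η.level_vertex hG]) hn⟩

/-- The boundary is the continuous image of a closed subset of the product of the finite spheres,
which is compact by Tychonoff. -/
lemma compactSpace_boundary [G.LocallyFinite] (hG : G.IsTree) : CompactSpace (Boundary G r) := by
  let _ : TopologicalSpace I := ⊥
  have : DiscreteTopology I := ⟨rfl⟩
  let K : Set (ℕ → I) := (fun x => x 0) ⁻¹' {r} ∩
    ⋂ n, (fun x => (x n, x (n + 1))) ⁻¹' {p : I × I | IsPred G r p.1 p.2}
  have mem_K : ∀ x, x ∈ K ↔ x 0 = r ∧ ∀ n, IsPred G r (x n) (x (n + 1)) := by simp [K]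
  have hKc : IsClosed K := by
    refine ((isClosed_discrete {r}).preimage (by fun_prop)).inter (isClosed_iInter fun n => ?_)
    exact (isClosed_discrete _).preimage (by fun_prop)
  have hKs : K ⊆ Set.univ.pi fun n => (sphereFinset G r n : Set I) := by
    intro x hx n _
    rw [mem_K] at hx
    exact (mem_sphereFinset hG).2 ((Boundary.ofIsPred hG x hx.1 hx.2).level_vertex hG n)
  have hK : IsCompact K :=
    (isCompact_univ_pi fun n => (sphereFinset G r n).finite_toSet.isCompact).of_isClosed_subset
      hKc hKs
  have : CompactSpace K := isCompact_iff_compactSpace.1 hK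
  let φ : K → Boundary G r := fun x =>
    Boundary.ofIsPred hG x.1 ((mem_K _).1 x.2).1 ((mem_K _).1 x.2).2
  have hφ : Continuous φ := by
    refine continuous_generateFrom_iff.2 ?_
    rintro _ ⟨i, rfl⟩
    have : φ ⁻¹' cylinder G r i = ⋃ n, (fun x : K => x.1 n) ⁻¹' {i} := by
      ext x
      simp [φ, cylinder, Boundary.geod, Boundary.ofIsPred]
    rw [this]
    exact isOpen_iUnion fun n =>
      (isOpen_discrete {i}).preimage ((continuous_apply n).comp continuous_subtype_val)
  refine Function.Surjective.compactSpace (f := φ) hφ fun ξ => ?_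
  exact ⟨⟨ξ.vertex, (mem_K _).2 ⟨ξ.vertex_zero, ξ.isPred hG⟩⟩, rfl⟩

/-! ### The tree matrix on the boundary -/

lemma bddAbove_level_inter (hG : G.IsTree) (i : I) (ξ : Boundary G r) :
    level G r i ∈ upperBounds (level G r '' (geod G r i ∩ ξ.geod)) := by
  rintro _ ⟨k, ⟨hk, -⟩, rfl⟩
  exact level_le_of_prec hG hk

lemma meetLevel_of_mem (hG : G.IsTree) {ξ : Boundary G r} (h : ξ ∈ cylinder G r i) :
    meetLevel G r i ξ = level G r i :=
  IsGreatest.csSup_eq ⟨⟨i, ⟨prec_refl hG i, h⟩, rfl⟩, bddAbove_level_inter hG i ξ⟩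

lemma IsPred.meetLevel_of_notMem (hG : G.IsTree) (hij : IsPred G r i j) {ξ : Boundary G r}
    (h : ξ ∉ cylinder G r j) : meetLevel G r j ξ = meetLevel G r i ξ := by
  have : geod G r j ∩ ξ.geod = geod G r i ∩ ξ.geod := by
    ext k
    refine and_congr_left fun hk => (hij.prec_iff hG).trans (or_iff_right ?_)
    rintro rfl
    exact h hk
  rw [meetLevel, this, meetLevel]

lemma U_root (hG : G.IsTree) (ξ : Boundary G r) : U G r w r ξ = w 0 := by
  rw [U, meetLevel_of_mem hG (by simp), level_root]

/-- Passing from `i` to `j` lengthens the common geodesic only for the boundary points below `j`,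
and then by one level. Integrability, monotonicity and the slopes of potentials all follow from
this. -/
lemma IsPred.U_eq (hG : G.IsTree) (hij : IsPred G r i j) (ξ : Boundary G r) :
    U G r w j ξ = U G r w i ξ
      + (cylinder G r j).indicator (fun _ => delta w (level G r j)) ξ := by
  by_cases h : ξ ∈ cylinder G r j
  · have hi : ξ ∈ cylinder G r i :=
      (mem_cylinder_iff_prec hG h (by rw [hij.level_eq hG]; omega)).2 hij.2
    rw [U, U, meetLevel_of_mem hG h, meetLevel_of_mem hG hi, Set.indicator_of_mem h,
      hij.level_eq hG, delta]
    ring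
  · rw [U, U, hij.meetLevel_of_notMem hG h, Set.indicator_of_notMem h, add_zero]

lemma integrable_U (hG : G.IsTree) (μ : Measure (Boundary G r)) [IsFiniteMeasure μ] (i : I) :
    Integrable (U G r w i) μ := by
  induction i using pred_induction hG (r := r) with
  | root => simp [funext (U_root (w := w) hG)]
  | step i j hij ih =>
    rw [funext (hij.U_eq (w := w) hG)]
    exact ih.add ((integrable_const _).indicator (measurableSet_cylinder j))

lemma slope_integral_U (hG : G.IsTree) (hw : ∀ n, 0 < delta w n)
    (μ : Measure (Boundary G r)) [IsFiniteMeasure μ] (i : I) :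
    slope G r w (fun i => ∫ ξ, U G r w i ξ ∂μ) i = μ.real (cylinder G r i) := by
  by_cases hi : i = r
  · subst hi
    have := (hw 0).ne'
    simp only [slope_root, U_root hG, integral_const, cylinder_root, smul_eq_mul]
    -- `delta w 0` unfolds to `w 0`, which is also the constant value of `U` at the root.
    change (w 0)⁻¹ * (_ * w 0) = _
    change w 0 ≠ 0 at this
    field_simp
  · have hp := isPred_pred hG hi
    rw [hp.slope_eq hG]
    simp only [hp.U_eq (w := w) hG]
    rw [integral_add (integrable_U hG μ _)
      ((integrable_const _).indicator (measurableSet_cylinder i)), add_sub_cancel_left,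
      integral_indicator_const _ (measurableSet_cylinder i), smul_eq_mul, mul_comm,
      mul_assoc, mul_inv_cancel₀ (hw _).ne', mul_one]

lemma sum_measureReal_cylinder_succFinset [G.LocallyFinite] (hG : G.IsTree)
    (μ : Measure (Boundary G r)) [IsFiniteMeasure μ] (i : I) :
    ∑ j ∈ succFinset G r i, μ.real (cylinder G r j) = μ.real (cylinder G r i) := by
  rw [cylinder_eq_biUnion_succFinset hG i, measureReal_biUnion_finset]
  · intro j hj k hk hjk
    rw [Finset.mem_coe, mem_succFinset] at hj hk
    exact disjoint_cylinder hG (by rw [hj.level_eq hG, hk.level_eq hG]) hjk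
  · exact fun j _ => measurableSet_cylinder j

lemma sum_measureReal_cylinder_sphereFinset [G.LocallyFinite] (hG : G.IsTree)
    (μ : Measure (Boundary G r)) [IsFiniteMeasure μ] (n : ℕ) :
    ∑ j ∈ sphereFinset G r n, μ.real (cylinder G r j) = μ.real Set.univ := by
  rw [← iUnion_cylinder_sphereFinset hG n, measureReal_biUnion_finset]
  · intro j hj k hk hjk
    rw [Finset.mem_coe, mem_sphereFinset hG] at hj hk
    exact disjoint_cylinder hG (by rw [hj, hk]) hjk
  · exact fun j _ => measurableSet_cylinder j

lemma isHarmonic_integral_U [G.LocallyFinite] (hG : G.IsTree) (hw : ∀ n, 0 < delta w n)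
    (μ : Measure (Boundary G r)) [IsFiniteMeasure μ] :
    IsHarmonic G r w fun i => ∫ ξ, U G r w i ξ ∂μ := by
  simp only [isHarmonic_iff hG, slope_integral_U hG hw]
  exact sum_measureReal_cylinder_succFinset hG μ

lemma isIncreasing_integral_U (hG : G.IsTree) (hw : ∀ n, 0 < delta w n)
    (μ : Measure (Boundary G r)) [IsFiniteMeasure μ] :
    IsIncreasing G r fun i => ∫ ξ, U G r w i ξ ∂μ := by
  refine isIncreasing_of_isPred hG fun i j hij => ?_
  refine integral_mono (integrable_U hG μ i) (integrable_U hG μ j) fun ξ => ?_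
  rw [hij.U_eq hG]
  exact le_add_of_nonneg_right (Set.indicator_nonneg (fun _ _ => (hw _).le) ξ)

lemma integral_U_sub_toSignedMeasure (hG : G.IsTree) (μ ν : Measure (Boundary G r))
    [IsFiniteMeasure μ] [IsFiniteMeasure ν] (i : I) :
    ∫ᵛ ξ, U G r w i ξ ∂<•(μ.toSignedMeasure - ν.toSignedMeasure)
      = ∫ ξ, U G r w i ξ ∂μ - ∫ ξ, U G r w i ξ ∂ν := by
  rw [VectorMeasure.integral_sub_vectorMeasure, VectorMeasure.integral_toSignedMeasure,
    VectorMeasure.integral_toSignedMeasure]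
  · simpa [VectorMeasure.Integrable] using integrable_U hG μ i
  · simpa [VectorMeasure.Integrable] using integrable_U hG ν i

lemma integral_U_signedMeasure (hG : G.IsTree) (ν : SignedMeasure (Boundary G r)) (i : I) :
    ∫ᵛ ξ, U G r w i ξ ∂<•ν = ∫ ξ, U G r w i ξ ∂ν.toJordanDecomposition.posPart
      - ∫ ξ, U G r w i ξ ∂ν.toJordanDecomposition.negPart := by
  conv_lhs => rw [← ν.toSignedMeasure_toJordanDecomposition]
  exact integral_U_sub_toSignedMeasure hG _ _ i

/-! ### Construction of measures on the boundary -/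

open Filter Topology CompactlySupported in
/-- The limit along an ultrafilter of a bounded sequence of positive finite combinations of Dirac
masses on a compact space is a measure. -/
lemma exists_measure_tendsto_sum {X : Type*} [TopologicalSpace X] [T2Space X] [CompactSpace X]
    [MeasurableSpace X] [BorelSpace X] (𝒰 : Ultrafilter ℕ) (s : ℕ → Finset I) (x : I → X)
    (a : I → ℝ) (ha : ∀ i, 0 ≤ a i) (C : ℝ) (hC : ∀ n, ∑ j ∈ s n, a j ≤ C) :
    ∃ μ : Measure X, IsFiniteMeasure μ ∧ ∀ f : C(X, ℝ),
      Tendsto (fun n => ∑ j ∈ s n, a j * f (x j)) 𝒰 (𝓝 (∫ y, f y ∂μ)) := by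
  -- Along an ultrafilter every bounded real sequence converges, so no subsequence depending on `f`
  -- is needed and the limit is linear in `f`.
  have hlim : ∀ f : C(X, ℝ), ∃ l, Tendsto (fun n => ∑ j ∈ s n, a j * f (x j)) 𝒰 (𝓝 l) := by
    intro f
    have hb : ∀ n, ∑ j ∈ s n, a j * f (x j) ∈ Set.Icc (-(C * ‖f‖)) (C * ‖f‖) := by
      intro n
      rw [Set.mem_Icc, ← abs_le]
      calc |∑ j ∈ s n, a j * f (x j)| ≤ ∑ j ∈ s n, |a j * f (x j)| :=
            Finset.abs_sum_le_sum_abs _ _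
        _ ≤ ∑ j ∈ s n, a j * ‖f‖ := by
            refine Finset.sum_le_sum fun j _ => ?_
            rw [abs_mul, abs_of_nonneg (ha j)]
            exact mul_le_mul_of_nonneg_left (f.norm_coe_le_norm (x j)) (ha j)
        _ ≤ C * ‖f‖ := by
            rw [← Finset.sum_mul]
            exact mul_le_mul_of_nonneg_right (hC n) (norm_nonneg f)
    obtain ⟨l, -, hl⟩ := isCompact_Icc.ultrafilter_le_nhds
      (𝒰.map fun n => ∑ j ∈ s n, a j * f (x j))
      (le_principal_iff.2 (Ultrafilter.mem_map.2 (Filter.univ_mem' hb)))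
    exact ⟨l, hl⟩
  choose L hL using hlim
  let Λ₀ : C_c(X, ℝ) →ₗ[ℝ] ℝ :=
    { toFun := fun f => L f.toContinuousMap
      map_add' := fun f g => by
        refine tendsto_nhds_unique (hL _) ?_
        convert (hL f.toContinuousMap).add (hL g.toContinuousMap) using 2 with n
        rw [← Finset.sum_add_distrib]
        exact Finset.sum_congr rfl fun j _ => mul_add _ _ _
      map_smul' := fun c f => by
        refine tendsto_nhds_unique (hL _) ?_
        change Tendsto _ _ (𝓝 (c * L f.toContinuousMap))
        convert (hL f.toContinuousMap).const_mul c using 2 with n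
        rw [Finset.mul_sum]
        exact Finset.sum_congr rfl fun j _ => mul_left_comm _ _ _ }
  let Λ : C_c(X, ℝ) →ₚ[ℝ] ℝ := PositiveLinearMap.mk₀ Λ₀ fun f hf =>
    ge_of_tendsto (hL f.toContinuousMap) <| Eventually.of_forall fun n =>
      Finset.sum_nonneg fun j _ => mul_nonneg (ha j) (hf (x j))
  refine ⟨RealRMK.rieszMeasure Λ, inferInstance, fun f => ?_⟩
  have := RealRMK.integral_rieszMeasure Λ ⟨f, HasCompactSupport.of_compactSpace _⟩
  change ∫ y, f y ∂_ = L f at this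
  rw [this]
  exact hL f

open Filter Topology in
/-- An additive function of bounded variation on the vertices of the tree is a difference of two
finite measures of the cylinders. -/
lemma exists_measures_of_additive [G.LocallyFinite] (hG : G.IsTree)
    (hbranch : ∀ i, (branch G r i).Infinite) {m : I → ℝ}
    (hm : ∀ i, ∑ j ∈ succFinset G r i, m j = m i) (C : ℝ)
    (hC : ∀ n, ∑ j ∈ sphereFinset G r n, |m j| ≤ C) :
    ∃ μ ν : Measure (Boundary G r), ∃ _ : IsFiniteMeasure μ, ∃ _ : IsFiniteMeasure ν,
      ∀ i, m i = μ.real (cylinder G r i) - ν.real (cylinder G r i) := by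
  classical
  have := t2Space_boundary (r := r) hG
  have := compactSpace_boundary (r := r) hG
  choose x hx using cylinder_nonempty hG hbranch
  have hpos : ∀ i, (m i)⁺ ≤ |m i| := fun i => by
    rw [← posPart_add_negPart]
    exact le_add_of_nonneg_right (negPart_nonneg _)
  have hneg : ∀ i, (m i)⁻ ≤ |m i| := fun i => by
    rw [← posPart_add_negPart]
    exact le_add_of_nonneg_left (posPart_nonneg _)
  obtain ⟨μ, hμ, hμt⟩ := exists_measure_tendsto_sum (hyperfilter ℕ) (sphereFinset G r) x
    (fun i => (m i)⁺) (fun i => posPart_nonneg _) C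
    fun n => (Finset.sum_le_sum fun j _ => hpos j).trans (hC n)
  obtain ⟨ν, hν, hνt⟩ := exists_measure_tendsto_sum (hyperfilter ℕ) (sphereFinset G r) x
    (fun i => (m i)⁻) (fun i => negPart_nonneg _) C
    fun n => (Finset.sum_le_sum fun j _ => hneg j).trans (hC n)
  refine ⟨μ, ν, hμ, hν, fun i => ?_⟩
  let f : C(Boundary G r, ℝ) :=
    ⟨(cylinder G r i).indicator fun _ => 1,
      (isClopen_cylinder hG i).continuous_indicator continuous_const⟩
  have hf : ∀ μ : Measure (Boundary G r), ∫ ξ, f ξ ∂μ = μ.real (cylinder G r i) := fun μ => by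
    simp [f, integral_indicator_const _ (measurableSet_cylinder i)]
  have hlim := (hμt f).sub (hνt f)
  rw [hf, hf] at hlim
  refine tendsto_nhds_unique (tendsto_const_nhds.congr' ?_) hlim
  -- The ultrafilter is free, so it contains every tail of `ℕ`.
  have hev : ∀ᶠ n in (hyperfilter ℕ : Filter ℕ), level G r i ≤ n :=
    Nat.hyperfilter_le_atTop (eventually_ge_atTop _)
  filter_upwards [hev] with n hn
  -- The parts m⁺ and m⁻ need not be additive; only their difference is, so the two sums are
  -- recombined before additivity is used.
  rw [← Finset.sum_sub_distrib, ← sum_sphereFinset_prec hG hm i hn]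
  refine Finset.sum_congr rfl fun j hj => ?_
  rw [mem_sphereFinset hG] at hj
  have hij := mem_cylinder_iff_prec (i := i) hG (hx j) (by rw [hj]; exact hn)
  rw [← sub_mul, posPart_sub_negPart]
  by_cases h : Prec G r i j
  · simp [f, h, hij.2 h]
  · simp [f, h, mt hij.1 h]

/-! ### ### Finite variation and representability -/

/-- Supplies the bound at level 0, which the finite variation condition leaves out. -/
lemma sum_sphereFinset_abs_zero_le [G.LocallyFinite] (hG : G.IsTree) {m : I → ℝ}
    (hm : ∀ i, ∑ j ∈ succFinset G r i, m j = m i) :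
    ∑ j ∈ sphereFinset G r 0, |m j| ≤ ∑ j ∈ sphereFinset G r 1, |m j| := by
  rw [sum_sphereFinset_succ hG]
  refine Finset.sum_le_sum fun j _ => ?_
  rw [← hm j]
  exact Finset.abs_sum_le_sum_abs _ _

lemma exists_isRepresentedBy [G.LocallyFinite] (hG : G.IsTree)
    (hbranch : ∀ i, (branch G r i).Infinite) (hw : ∀ n, 0 < delta w n) {h : I → ℝ}
    (h_harm : IsHarmonic G r w h) (hfv : FiniteVariation G r w h) :
    ∃ ν : SignedMeasure (Boundary G r), IsRepresentedBy G r w h ν := by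
  obtain ⟨C, hC⟩ := hfv
  have hC1 : ∀ n, 1 ≤ n → ∑ j ∈ sphereFinset G r n, |slope G r w h j| ≤ C := fun n hn => by
    rw [← levelVariation_eq_sum hG hw h hn]
    exact hC ⟨n, hn, rfl⟩
  have hm := (isHarmonic_iff hG h).1 h_harm
  obtain ⟨μ, ν, hμ, hν, heq⟩ := exists_measures_of_additive hG hbranch hm C fun n => by
    rcases n.eq_zero_or_pos with rfl | hn
    · exact (sum_sphereFinset_abs_zero_le hG hm).trans (hC1 1 le_rfl)
    · exact hC1 n hn
  refine ⟨μ.toSignedMeasure - ν.toSignedMeasure, fun i => ?_⟩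
  rw [integral_U_sub_toSignedMeasure hG]
  -- Both sides have the same slopes, and slopes determine a function by induction from the root.
  refine eq_of_slope_eq hG hw (r := r)
    (g := fun i => ∫ ξ, U G r w i ξ ∂μ - ∫ ξ, U G r w i ξ ∂ν) (fun i => ?_) i
  rw [slope_sub, slope_integral_U hG hw, slope_integral_U hG hw, heq]

lemma IsRepresentedBy.finiteVariation [G.LocallyFinite] (hG : G.IsTree)
    (hw : ∀ n, 0 < delta w n) {h : I → ℝ} {ν : SignedMeasure (Boundary G r)}
    (hν : IsRepresentedBy G r w h ν) : FiniteVariation G r w h := by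
  have heq : h = fun i => ∫ ξ, U G r w i ξ ∂ν.toJordanDecomposition.posPart
      - ∫ ξ, U G r w i ξ ∂ν.toJordanDecomposition.negPart :=
    funext fun i => (hν i).trans (integral_U_signedMeasure hG ν i)
  refine ⟨ν.toJordanDecomposition.posPart.real Set.univ
    + ν.toJordanDecomposition.negPart.real Set.univ, ?_⟩
  rintro _ ⟨n, hn, rfl⟩
  rw [levelVariation_eq_sum hG hw h hn, ← sum_measureReal_cylinder_sphereFinset hG _ n,
    ← sum_measureReal_cylinder_sphereFinset hG _ n, ← Finset.sum_add_distrib]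
  refine Finset.sum_le_sum fun j _ => ?_
  rw [heq, slope_sub, slope_integral_U hG hw, slope_integral_U hG hw]
  refine (abs_sub _ _).trans ?_
  rw [abs_of_nonneg measureReal_nonneg, abs_of_nonneg measureReal_nonneg]

end TreeMatrix

end

theorem mainTheorem2 {I : Type*} (G : SimpleGraph I) [G.LocallyFinite] (hG : G.IsTree) (r : I)
    (hbranch : ∀ i, (TreeMatrix.branch G r i).Infinite)
    (w : ℕ → ℝ) (hw_pos : ∀ n, 0 < w n) (hw_mono : StrictMono w)
    (h : I → ℝ) (h_harm : TreeMatrix.IsHarmonic G r w h) (h_bdd : ∃ C, ∀ i, |h i| ≤ C) :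
    ((∃ ν : SignedMeasure (TreeMatrix.Boundary G r), TreeMatrix.IsRepresentedBy G r w h ν) ↔
      TreeMatrix.FiniteVariation G r w h) ∧
    ∀ ν : SignedMeasure (TreeMatrix.Boundary G r), TreeMatrix.IsRepresentedBy G r w h ν →
      ∀ hp hm : I → ℝ,
        (∀ i, hp i = ∫ ξ, TreeMatrix.U G r w i ξ ∂ν.toJordanDecomposition.posPart) →
        (∀ i, hm i = ∫ ξ, TreeMatrix.U G r w i ξ ∂ν.toJordanDecomposition.negPart) →
          (∀ i, h i = hp i - hm i) ∧
          (∀ i, 0 ≤ hp i) ∧ TreeMatrix.IsHarmonic G r w hp ∧ TreeMatrix.IsIncreasing G r hp ∧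
          (∀ i, 0 ≤ hm i) ∧ TreeMatrix.IsHarmonic G r w hm ∧ TreeMatrix.IsIncreasing G r hm := by
  have hw := TreeMatrix.delta_pos hw_pos hw_mono
  refine ⟨⟨fun ⟨_, hν⟩ => hν.finiteVariation hG hw,
    TreeMatrix.exists_isRepresentedBy hG hbranch hw h_harm⟩, fun ν hν hp hm hhp hhm => ?_⟩
  obtain rfl := funext hhp
  obtain rfl := funext hhm
  exact ⟨fun i => (hν i).trans (TreeMatrix.integral_U_signedMeasure hG ν i),
    fun i => integral_nonneg fun ξ => (hw_pos _).le, TreeMatrix.isHarmonic_integral_U hG hw _,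
    TreeMatrix.isIncreasing_integral_U hG hw _,
    fun i => integral_nonneg fun ξ => (hw_pos _).le, TreeMatrix.isHarmonic_integral_U hG hw _,
    TreeMatrix.isIncreasing_integral_U hG hw _⟩
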